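/- For $0\le\alpha<\pi/2$ let $$D_\alpha=\{z\in\mathbb C:|z|\le\sin\alpha\}\cup\{z\in\mathbb C:|\arg(1-z)|\le\alpha,\ |z-1|\le\cos\alpha\}$$ (with $z=1$ included), and for a bounded operator $C$ on a complex Hilbert space $\mathfrak H$ let $W(C)=\{(Cx,x):x\in\mathfrak H,\ \|x\|=1\}$ be its numerical range. A contraction $C$ (that is, $\|C\|\le 1$) on $\mathfrak H$ is called quasi-sectorial with semi-angle $\alpha$ if $W(C)\subseteq D_\alpha$. Theorem. Let $0\le\alpha<\pi/2$. There is a constant $K$, depending only on $\alpha$, such that every quasi-sectorial contraction $C$ with semi-angle $\alpha$ on a complex Hilbert space satisfies $$\|C^n(1-C)\|\le\frac{K}{n+1},\qquad n=0,1,2,\dots,$$ and $$\bigl\|C^n-e^{n(C-1)}\bigr\|\le\frac{2K+2}{n^{1/3}},\qquad n=1,2,3,\dots,$$ in the operator norm. Moreover, for each such $C$ and every real $K'$ with $\|C^n(1-C)\|\le K'/(n+1)$ for all $n\ge 1$, one has $\|C^n-e^{n(C-1)}\|\le (2K'+2)/n^{1/3}$ for all $n\ge1$. -/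

import Mathlib

/-- The numerical range `W(C) = {(C x, x) : ‖x‖ = 1}` of a bounded operator; Mathlib's inner
product is linear in the second argument. -/
def numRange {H : Type*} [NormedAddCommGroup H] [InnerProductSpace ℂ H]
    (C : H →L[ℂ] H) : Set ℂ :=
  {w | ∃ x : H, ‖x‖ = 1 ∧ w = inner ℂ x (C x)}

/-- The set `D_α`: the disc of radius `sin α` around `0` together with the closed circular sector
of radius `cos α` and half-angle `α` at the vertex `1` (the vertex belongs to the set, since
`Complex.arg 0 = 0`). -/
def quasiSector (α : ℝ) : Set ℂ :=
  {z | ‖z‖ ≤ Real.sin α} ∪ {z | |Complex.arg (1 - z)| ≤ α ∧ ‖z - 1‖ ≤ Real.cos α}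

/-- `C` is a quasi-sectorial contraction with semi-angle `α` with respect to the vertex `1`. -/
structure IsQuasiSectorialContraction {H : Type*} [NormedAddCommGroup H]
    [InnerProductSpace ℂ H] (α : ℝ) (C : H →L[ℂ] H) : Prop where
  norm_le_one : ‖C‖ ≤ 1
  numRange_subset : numRange C ⊆ quasiSector α

/-! Since `α < π/2`, `D_α` meets the unit circle only at `1`, inside a sector narrower than a
half-plane. Hence `1 - z(1 - w)` stays in the unit disc for all `w` in `D_α` and all complex `z`
within some `r(α)` of `1`, so `1 - z(1 - C)` has numerical radius at most one. Berger's inequality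
bounds its powers by `2`; Cauchy's estimate at `z = 1` then gives the first claim with `K = 2 / r`.

For the second, `exp (n(C - 1))` is the mean of `C ^ m` for `m` Poisson of parameter `n`.
Telescoping the first bound controls `C ^ n - C ^ m` by `|n - m|`, whose typical size is `√n`. This
gives order `n^(-1/2)`, more than is claimed (`norm_pow_sub_exp_le`). -/

/-- The sum of the `m`-th powers of the `n`-th roots of unity vanishes for `0 < m < n`. -/
theorem IsPrimitiveRoot.sum_pow_pow_eq_zero {ω : ℂ} {n m : ℕ} (hω : IsPrimitiveRoot ω n)
    (hm : 0 < m) (hmn : m < n) : ∑ j ∈ Finset.range n, (ω ^ j) ^ m = 0 := by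
  have h1 : ω ^ m ≠ 1 := hω.pow_ne_one_of_pos_of_lt hm.ne' hmn
  have h2 := mul_neg_geom_sum (ω ^ m) n
  rw [← pow_mul, mul_comm m n, pow_mul, hω.pow_eq_one, one_pow, sub_self] at h2
  have h3 := (mul_eq_zero.mp h2).resolve_left (sub_ne_zero.mpr h1.symm)
  rw [← h3]
  exact Finset.sum_congr rfl fun j _ => by rw [← pow_mul, ← pow_mul, mul_comm]

/-! ### Numerical radius and powers -/

section NumericalRadius

variable {H : Type*} [NormedAddCommGroup H] [InnerProductSpace ℂ H]

/-- Factor `1 - T ^ n = (1 - ω ^ j T) ∑ (ω ^ j T) ^ m` for each `j`. The resulting vectors `y j`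
average to `x`, and each `(y j, (1 - ω ^ j T) y j)` has nonnegative real part. -/
theorem re_inner_pow_le {T : H →L[ℂ] H} (hT : ∀ x, ‖inner ℂ x (T x)‖ ≤ ‖x‖ ^ 2)
    {n : ℕ} (hn : 0 < n) (x : H) : (inner ℂ x ((T ^ n) x)).re ≤ ‖x‖ ^ 2 := by
  obtain ⟨ω, hω⟩ : ∃ ω : ℂ, IsPrimitiveRoot ω n := ⟨_, Complex.isPrimitiveRoot_exp n hn.ne'⟩
  set y : ℕ → H := fun j => (∑ m ∈ Finset.range n, ((ω ^ j) • T) ^ m) x with hy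
  have hsum : ∑ j ∈ Finset.range n, y j = (n : ℂ) • x := by
    simp only [hy, smul_pow, sum_apply, smul_apply]
    rw [Finset.sum_comm]
    simp_rw [← Finset.sum_smul]
    rw [Finset.sum_eq_single_of_mem 0 (Finset.mem_range.mpr hn)]
    · simp
    · intro m hm hm0
      rw [hω.sum_pow_pow_eq_zero (Nat.pos_of_ne_zero hm0) (Finset.mem_range.mp hm), zero_smul]
  have hfac : ∀ j, x - (T ^ n) x = y j - (ω ^ j) • T (y j) := by
    intro j
    have h1 := mul_neg_geom_sum ((ω ^ j) • T) n
    rw [smul_pow, ← pow_mul, mul_comm j n, pow_mul, hω.pow_eq_one, one_pow, one_smul] at h1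
    exact (congrArg (fun S : H →L[ℂ] H => S x) h1).symm
  have hnonneg : ∀ j, 0 ≤ (inner ℂ (y j) (x - (T ^ n) x)).re := by
    intro j
    have hωn : ‖ω ^ j‖ = 1 := by
      rw [norm_pow, Complex.norm_eq_one_of_pow_eq_one hω.pow_eq_one hn.ne', one_pow]
    have h1 : ‖(ω ^ j) * inner ℂ (y j) (T (y j))‖ ≤ ‖y j‖ ^ 2 := by
      rw [norm_mul, hωn, one_mul]
      exact hT _
    have h2 := (Complex.re_le_norm _).trans h1
    have h3 : (inner ℂ (y j) (y j)).re = ‖y j‖ ^ 2 := by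
      simpa using inner_self_eq_norm_sq (𝕜 := ℂ) (y j)
    rw [hfac j, inner_sub_right, inner_smul_right, Complex.sub_re, h3]
    linarith
  have htot : 0 ≤ (inner ℂ ((n : ℂ) • x) (x - (T ^ n) x)).re := by
    rw [← hsum, sum_inner, Complex.re_sum]
    exact Finset.sum_nonneg fun j _ => hnonneg j
  have h3 : (inner ℂ x x).re = ‖x‖ ^ 2 := by
    simpa using inner_self_eq_norm_sq (𝕜 := ℂ) x
  rw [inner_smul_left, Complex.conj_natCast, ← Complex.ofReal_natCast, Complex.re_ofReal_mul,
    inner_sub_right, Complex.sub_re, h3] at htot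
  have h4 := nonneg_of_mul_nonneg_right htot (by exact_mod_cast hn : (0 : ℝ) < n)
  linarith

/-- **Berger's power inequality** for operators of numerical radius at most one. -/
theorem norm_inner_pow_le {T : H →L[ℂ] H} (hT : ∀ x, ‖inner ℂ x (T x)‖ ≤ ‖x‖ ^ 2)
    {n : ℕ} (hn : 0 < n) (x : H) : ‖inner ℂ x ((T ^ n) x)‖ ≤ ‖x‖ ^ 2 := by
  set w := inner ℂ x ((T ^ n) x) with hw
  -- Rotating `T` by an `n`-th root of the opposite phase makes the inner product real and
  -- nonnegative.
  obtain ⟨c, hc⟩ : ∃ c : ℂ, c ^ n = Complex.exp (-(Complex.arg w) * Complex.I) :=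
    IsAlgClosed.exists_pow_nat_eq _ hn
  have hc1 : ‖c‖ = 1 := by
    have : ‖c‖ ^ n = 1 := by
      rw [← norm_pow, hc, ← Complex.ofReal_neg, Complex.norm_exp_ofReal_mul_I]
    exact (pow_eq_one_iff_of_nonneg (norm_nonneg _) hn.ne').mp this
  have h := re_inner_pow_le (T := c • T) (fun x => by
    rw [smul_apply, inner_smul_right, norm_mul, hc1, one_mul]
    exact hT x) hn x
  rw [smul_pow, smul_apply, inner_smul_right, hc, ← hw] at h
  have h2 : Complex.exp (-(Complex.arg w) * Complex.I) * w = ‖w‖ := by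
    have h3 := Complex.norm_mul_exp_arg_mul_I w
    rw [neg_mul, Complex.exp_neg, inv_mul_eq_iff_eq_mul₀ (Complex.exp_ne_zero _), mul_comm]
    exact h3.symm
  rwa [h2, Complex.ofReal_re] at h

/-- The norm of an operator is at most twice its numerical radius. -/
theorem opNorm_le_two_of_norm_inner_le {S : H →L[ℂ] H}
    (hS : ∀ x, ‖inner ℂ x (S x)‖ ≤ ‖x‖ ^ 2) : ‖S‖ ≤ 2 := by
  refine ContinuousLinearMap.opNorm_le_of_re_inner_le zero_le_two fun x y hx hy => ?_
  refine (Complex.re_le_norm _).trans ?_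
  have hS' : ∀ v, ‖inner ℂ (S v) v‖ ≤ ‖v‖ ^ 2 := fun v => by
    rw [norm_inner_symm]
    exact hS v
  -- Polarization uses four quadratic values; by the parallelogram law their bounds sum to `8` for
  -- unit vectors.
  have key := inner_map_polarization' (S : H →ₗ[ℂ] H) x y
  simp only [ContinuousLinearMap.coe_coe] at key
  rw [key, norm_div]
  have hp := parallelogram_law_with_norm ℂ x y
  have hq := parallelogram_law_with_norm ℂ x (Complex.I • y)
  rw [norm_smul, Complex.norm_I, one_mul] at hq
  have h4 : ‖(4 : ℂ)‖ = 4 := by simp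
  rw [h4, div_le_iff₀ (by norm_num)]
  refine (norm_add_le _ _).trans ?_
  refine (add_le_add_left ((norm_sub_le _ _).trans (add_le_add_left (norm_sub_le _ _) _)) _).trans ?_
  simp only [norm_mul, Complex.norm_I, one_mul]
  have e1 := hS' (x + y)
  have e2 := hS' (x - y)
  have e3 := hS' (x + Complex.I • y)
  have e4 := hS' (x - Complex.I • y)
  rw [hx, hy] at hp hq
  nlinarith

/-- An operator of numerical radius at most one is power bounded, with constant two. -/
theorem norm_pow_le_two {T : H →L[ℂ] H} (hT : ∀ x, ‖inner ℂ x (T x)‖ ≤ ‖x‖ ^ 2)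
    {n : ℕ} (hn : 0 < n) : ‖T ^ n‖ ≤ 2 :=
  opNorm_le_two_of_norm_inner_le fun x => norm_inner_pow_le hT hn x

end NumericalRadius

/-! ### Geometry of `D_α` -/

/-- The dilations of `1 - quasiSector α` by factors near `1` stay in the unit disc around `1`. -/
theorem exists_forall_quasiSector_norm_le_one {α : ℝ} (hα₀ : 0 ≤ α) (hα : α < Real.pi / 2) :
    ∃ r : ℝ, 0 < r ∧ ∀ w ∈ quasiSector α, ∀ z : ℂ, ‖z - 1‖ ≤ r → ‖1 - z * (1 - w)‖ ≤ 1 := by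
  have hc : 0 < Real.cos α := Real.cos_pos_of_mem_Ioo ⟨by linarith, hα⟩
  have hs : Real.sin α < 1 := by
    nlinarith [Real.sin_sq_add_cos_sq α, Real.sin_le_one α]
  -- The second entry gives `sin α + 2r ≤ 1` on the disc; the first gives `‖z‖² ≤ 3/2` and `(3/2)
  -- cos α ≤ 2 cos α - 2r` on the sector.
  refine ⟨min (Real.cos α / 8) ((1 - Real.sin α) / 2),
    lt_min (by positivity) (by linarith), fun w hw z hz => ?_⟩
  set r := min (Real.cos α / 8) ((1 - Real.sin α) / 2)
  have hr1 : r ≤ Real.cos α / 8 := min_le_left _ _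
  have hr2 : r ≤ (1 - Real.sin α) / 2 := min_le_right _ _
  rcases hw with hw | ⟨harg, hnorm⟩
  · have hw' : ‖w‖ ≤ Real.sin α := hw
    have e : 1 - z * (1 - w) = w - (z - 1) * (1 - w) := by ring
    have h1 : ‖1 - w‖ ≤ 2 := (norm_sub_le _ _).trans (by rw [norm_one]; linarith)
    rw [e]
    refine (norm_sub_le _ _).trans ?_
    rw [norm_mul]
    nlinarith [norm_nonneg (z - 1), norm_nonneg (1 - w)]
  · set a := 1 - w with ha
    have hna : ‖a‖ ≤ Real.cos α := by rwa [ha, norm_sub_rev]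
    have hre : ‖a‖ * Real.cos α ≤ a.re := by
      rw [← Complex.norm_mul_cos_arg a]
      refine mul_le_mul_of_nonneg_left ?_ (norm_nonneg _)
      rw [← Real.cos_abs (Complex.arg a)]
      exact Real.cos_le_cos_of_nonneg_of_le_pi (abs_nonneg _) (by linarith [Real.pi_pos]) harg
    have hz1 : ‖z‖ ≤ 1 + r := by
      have := norm_add_le (z - 1) 1
      rw [sub_add_cancel, norm_one] at this
      linarith
    have hza : a.re - r * ‖a‖ ≤ (z * a).re := by
      have h1 : (z * a).re = a.re + ((z - 1) * a).re := by
        rw [← Complex.add_re]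
        congr 1
        ring
      have h2 := neg_le_of_abs_le (Complex.abs_re_le_norm ((z - 1) * a))
      rw [norm_mul] at h2
      nlinarith [norm_nonneg a]
    have hsq : ‖1 - z * a‖ ^ 2 = 1 - 2 * (z * a).re + (‖z‖ * ‖a‖) ^ 2 := by
      rw [← norm_mul, Complex.sq_norm, Complex.sq_norm, Complex.normSq_apply,
        Complex.normSq_apply, Complex.sub_re, Complex.sub_im, Complex.one_re, Complex.one_im]
      ring
    have hc1 := Real.cos_le_one α
    have hz2 : ‖z‖ ^ 2 ≤ 3 / 2 := by nlinarith [norm_nonneg z]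
    have hmain : (‖z‖ * ‖a‖) ^ 2 ≤ 2 * (z * a).re := by
      have h1 : ‖z‖ ^ 2 * ‖a‖ ≤ 3 / 2 * Real.cos α :=
        mul_le_mul hz2 hna (norm_nonneg _) (by norm_num)
      have h2 : ‖a‖ * (‖z‖ ^ 2 * ‖a‖) ≤ ‖a‖ * (2 * Real.cos α - 2 * r) :=
        mul_le_mul_of_nonneg_left (by linarith) (norm_nonneg _)
      nlinarith
    exact (sq_le_one_iff₀ (norm_nonneg _)).mp (by linarith)

/-! ### The Ritt-type bound -/

section PowerBounds

variable {H : Type*} [NormedAddCommGroup H] [InnerProductSpace ℂ H]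

theorem norm_inner_one_sub_smul_le {α r : ℝ}
    (hr : ∀ w ∈ quasiSector α, ∀ z : ℂ, ‖z - 1‖ ≤ r → ‖1 - z * (1 - w)‖ ≤ 1)
    {C : H →L[ℂ] H} (hC : numRange C ⊆ quasiSector α) {z : ℂ} (hz : ‖z - 1‖ ≤ r) (x : H) :
    ‖inner ℂ x ((1 - z • (1 - C)) x)‖ ≤ ‖x‖ ^ 2 := by
  rcases eq_or_ne x 0 with rfl | hx
  · simp
  have hx0 : (‖x‖ : ℂ) ≠ 0 := by simpa using hx
  set u : H := ((‖x‖ : ℂ)⁻¹) • x with hu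
  have hu1 : ‖u‖ = 1 := by
    rw [hu, norm_smul, norm_inv, Complex.norm_real, norm_norm, inv_mul_cancel₀ (by simpa using hx)]
  have hxu : x = (‖x‖ : ℂ) • u := by rw [hu, smul_smul, mul_inv_cancel₀ hx0, one_smul]
  have h1 := hr _ (hC ⟨u, hu1, rfl⟩) z hz
  have h2 : inner ℂ u ((1 - z • (1 - C)) u) = 1 - z * (1 - inner ℂ u (C u)) := by
    simp [inner_self_eq_norm_sq_to_K, hu1]
  rw [← h2] at h1
  conv_lhs => rw [hxu]
  rw [map_smul, inner_smul_left, inner_smul_right, norm_mul, norm_mul, Complex.conj_ofReal,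
    Complex.norm_real, norm_norm]
  nlinarith [mul_le_mul_of_nonneg_left h1 (sq_nonneg ‖x‖)]

theorem hasDerivAt_one_sub_smul_pow {A : Type*} [NormedRing A] [NormedAlgebra ℂ A] (a : A)
    (n : ℕ) (z : ℂ) : HasDerivAt (fun z : ℂ => (1 - z • a) ^ (n + 1))
      (-((n + 1 : ℂ) • ((1 - z • a) ^ n * a))) z := by
  have h0 : HasDerivAt (fun z : ℂ => 1 - z • a) (-a) z := by
    simpa using ((hasDerivAt_id z).smul_const a).const_sub 1
  induction n with
  | zero => simpa using h0
  | succ n ih =>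
    have h := ih.fun_mul h0
    simp only [← pow_succ] at h
    have hcomm : Commute a (1 - z • a) :=
      (Commute.one_right a).sub_right ((Commute.refl a).smul_right z)
    refine h.congr_deriv ?_
    rw [neg_mul, smul_mul_assoc, mul_assoc, hcomm.eq, ← mul_assoc, ← pow_succ, mul_neg, ← neg_add]
    rw [Nat.cast_succ, add_smul ((n : ℂ) + 1) 1, one_smul]

/-- The Ritt-type bound, by Cauchy's estimate for `z ↦ (1 - z (1 - C)) ^ (n + 1)` at `z = 1`. -/
theorem norm_pow_mul_one_sub_le {α r : ℝ} (hr0 : 0 < r)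
    (hr : ∀ w ∈ quasiSector α, ∀ z : ℂ, ‖z - 1‖ ≤ r → ‖1 - z * (1 - w)‖ ≤ 1)
    {C : H →L[ℂ] H} (hC : numRange C ⊆ quasiSector α) (n : ℕ) :
    ‖C ^ n * (1 - C)‖ ≤ 2 / r / ((n : ℝ) + 1) := by
  have hd := hasDerivAt_one_sub_smul_pow (1 - C) n
  have h := Complex.norm_deriv_le_of_forall_mem_sphere_norm_le (c := 1) hr0
    (Differentiable.diffContOnCl fun z => (hd z).differentiableAt) (C := 2) (fun z hz =>
      norm_pow_le_two (norm_inner_one_sub_smul_le hr hC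
        (by rw [← dist_eq_norm]; exact (Metric.mem_sphere.mp hz).le)) n.succ_pos)
  rw [(hd 1).deriv, norm_neg, norm_smul, one_smul, sub_sub_cancel] at h
  have hn : ‖(n + 1 : ℂ)‖ = (n : ℝ) + 1 := by
    exact_mod_cast Complex.norm_natCast (n + 1)
  rw [hn] at h
  rw [le_div_iff₀ (by positivity)]
  linarith

end PowerBounds

/-! ### Poisson moments -/

section Poisson

theorem hasSum_pow_div_factorial (t : ℝ) :
    HasSum (fun m : ℕ => t ^ m / m.factorial) (Real.exp t) := by
  rw [Real.exp_eq_exp_ℝ]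
  exact NormedSpace.expSeries_div_hasSum_exp t

theorem hasSum_mul_pow_div_factorial (t : ℝ) :
    HasSum (fun m : ℕ => (m : ℝ) * (t ^ m / m.factorial)) (t * Real.exp t) := by
  rw [← hasSum_nat_add_iff' 1]
  simp only [Finset.sum_range_one, Nat.cast_zero, zero_mul, sub_zero]
  refine ((hasSum_pow_div_factorial t).mul_left t).congr_fun fun m => ?_
  rw [Nat.factorial_succ]
  push_cast
  field_simp
  ring

theorem hasSum_sq_mul_pow_div_factorial (t : ℝ) :
    HasSum (fun m : ℕ => (m : ℝ) ^ 2 * (t ^ m / m.factorial)) ((t ^ 2 + t) * Real.exp t) := by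
  rw [← hasSum_nat_add_iff' 1]
  simp only [Finset.sum_range_one, Nat.cast_zero, ne_eq, OfNat.ofNat_ne_zero, not_false_eq_true,
    zero_pow, zero_mul, sub_zero]
  have h := ((hasSum_mul_pow_div_factorial t).add (hasSum_pow_div_factorial t)).mul_left t
  rw [show t * (t * Real.exp t + Real.exp t) = (t ^ 2 + t) * Real.exp t by ring] at h
  refine h.congr_fun fun m => ?_
  rw [Nat.factorial_succ]
  push_cast
  field_simp
  ring

theorem hasSum_inv_succ_mul_pow_div_factorial {t : ℝ} (ht : t ≠ 0) :
    HasSum (fun m : ℕ => ((m : ℝ) + 1)⁻¹ * (t ^ m / m.factorial)) ((Real.exp t - 1) / t) := by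
  have h := ((hasSum_nat_add_iff' 1).mpr (hasSum_pow_div_factorial t)).mul_left t⁻¹
  simp only [Finset.sum_range_one, pow_zero, Nat.factorial_zero, Nat.cast_one, div_one] at h
  rw [div_eq_inv_mul]
  refine h.congr_fun fun m => ?_
  rw [Nat.factorial_succ]
  push_cast
  field_simp
  ring

/-- A weighted mean deviation of the Poisson distribution, with `|t - m|` replaced by its
upper bound `(s + (t - m) ^ 2 / s) / 2`. -/
theorem hasSum_poisson_deviation {t s : ℝ} (ht : t ≠ 0) (ht1 : t + 1 ≠ 0) (hs : s ≠ 0) :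
    HasSum (fun m : ℕ => t ^ m / m.factorial *
        ((s + (t - m) ^ 2 / s) / 2 * (1 / (t + 1) + 1 / ((m : ℝ) + 1))))
      ((s + t / s) / 2 * (Real.exp t / (t + 1)) + s / 2 * ((Real.exp t - 1) / t)
        + 1 / (2 * s) * ((t + 1) ^ 2 * ((Real.exp t - 1) / t) - (t + 1) * Real.exp t)) := by
  have h0 := hasSum_pow_div_factorial t
  have h1 := hasSum_mul_pow_div_factorial t
  have h2 := hasSum_sq_mul_pow_div_factorial t
  have h3 := hasSum_inv_succ_mul_pow_div_factorial ht
  have hA := (((h0.mul_left (s + t ^ 2 / s)).add (h1.mul_left (-2 * t / s))).add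
    (h2.mul_left (1 / s))).mul_left (1 / (2 * (t + 1)))
  -- From `t - m = (t + 1) - (m + 1)`: `(t - m)² / (m + 1) = (t + 1)² / (m + 1) - (2t + 1) + m`.
  have hB := (h3.mul_left (s / 2 + (t + 1) ^ 2 / (2 * s))).add
    ((h0.mul_left (-(2 * t + 1) / (2 * s))).add (h1.mul_left (1 / (2 * s))))
  have hAB : HasSum (fun m : ℕ => t ^ m / m.factorial *
      ((s + (t - m) ^ 2 / s) / 2 * (1 / (t + 1) + 1 / ((m : ℝ) + 1)))) _ :=
    (hA.add hB).congr_fun fun m => by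
      have hm : (m : ℝ) + 1 ≠ 0 := by positivity
      field_simp
      ring
  convert hAB using 1
  field_simp
  ring

end Poisson

/-! ### Comparison of powers with the exponential -/

section Chernoff

variable {A : Type*} [NormedRing A] {c : A} {K : ℝ}

theorem norm_pow_sub_pow_add_le (hK : ∀ n : ℕ, 1 ≤ n → ‖c ^ n * (1 - c)‖ ≤ K / ((n : ℝ) + 1))
    (hK0 : 0 ≤ K) {a : ℕ} (ha : 1 ≤ a) (k : ℕ) :
    ‖c ^ a - c ^ (a + k)‖ ≤ K * k / ((a : ℝ) + 1) := by
  induction k with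
  | zero => simp
  | succ k ih =>
    have e : c ^ a - c ^ (a + (k + 1)) = (c ^ a - c ^ (a + k)) + c ^ (a + k) * (1 - c) := by
      rw [mul_sub, mul_one, ← pow_succ, ← add_assoc]
      abel
    rw [e]
    refine (norm_add_le _ _).trans ?_
    have h1 := hK (a + k) (by omega)
    have h2 : K / (((a + k : ℕ) : ℝ) + 1) ≤ K / ((a : ℝ) + 1) := by
      push_cast
      gcongr
      linarith [(Nat.cast_nonneg k : (0 : ℝ) ≤ k)]
    have h3 : K * ((k + 1 : ℕ) : ℝ) / ((a : ℝ) + 1)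
        = K * k / ((a : ℝ) + 1) + K / ((a : ℝ) + 1) := by
      push_cast
      ring
    linarith

/-- The sum of reciprocals replaces the reciprocal at the smaller index: it is symmetric and can be
averaged without splitting at `m = n`. -/
theorem norm_pow_sub_pow_le (hK : ∀ n : ℕ, 1 ≤ n → ‖c ^ n * (1 - c)‖ ≤ K / ((n : ℝ) + 1))
    (hK0 : 0 ≤ K) {n m : ℕ} (hn : 1 ≤ n) (hm : 1 ≤ m) :
    ‖c ^ n - c ^ m‖ ≤ K * (|(n : ℝ) - m| * (1 / ((n : ℝ) + 1) + 1 / ((m : ℝ) + 1))) := by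
  wlog h : n ≤ m generalizing n m
  · have := this hm hn (by omega)
    rw [norm_sub_rev, abs_sub_comm, add_comm (1 / _)]
    exact this
  obtain ⟨k, rfl⟩ := Nat.exists_eq_add_of_le h
  refine (norm_pow_sub_pow_add_le hK hK0 hn k).trans ?_
  have e : |(n : ℝ) - ((n + k : ℕ) : ℝ)| = k := by
    push_cast
    rw [sub_add_cancel_left, abs_neg, Nat.abs_cast]
  rw [e, mul_div_assoc, div_eq_mul_one_div (k : ℝ)]
  gcongr
  simp only [le_add_iff_nonneg_right]
  positivity

theorem hasSum_exp_smul_sub_one [NormedAlgebra ℂ A] [CompleteSpace A] (c : A) (t : ℝ) :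
    HasSum (fun m : ℕ => ((Real.exp (-t) * (t ^ m / m.factorial) : ℝ) : ℂ) • c ^ m)
      (NormedSpace.exp ((t : ℂ) • (c - 1))) := by
  have h1 := (NormedSpace.exp_series_hasSum_exp' (𝕂 := ℂ) ((t : ℂ) • c)).const_smul
    ((Real.exp (-t) : ℝ) : ℂ)
  have h2 : NormedSpace.exp ((t : ℂ) • (c - 1))
      = ((Real.exp (-t) : ℝ) : ℂ) • NormedSpace.exp ((t : ℂ) • c) := by
    let _ : NormedAlgebra ℚ A := NormedAlgebra.restrictScalars ℚ ℂ A
    have e : (t : ℂ) • (c - 1) = algebraMap ℂ A (-(t : ℂ)) + (t : ℂ) • c := by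
      rw [Algebra.algebraMap_eq_smul_one, smul_sub, neg_smul]
      abel
    rw [e, NormedSpace.exp_add_of_commute (Algebra.commutes _ _), ← NormedSpace.algebraMap_exp_comm,
      ← Complex.exp_eq_exp_ℂ, ← Algebra.smul_def, Complex.ofReal_exp, Complex.ofReal_neg]
  rw [h2]
  refine h1.congr_fun fun m => ?_
  rw [smul_pow, smul_smul, smul_smul]
  congr 1
  push_cast
  ring

theorem two_mul_exp_neg_add_le {K : ℝ} (hK0 : 0 ≤ K) {n : ℕ} (hn : 1 ≤ n) :
    2 * Real.exp (-n) + K * (2 / √n) ≤ (2 * K + 2) / (n : ℝ) ^ (1 / 3 : ℝ) := by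
  have hn1 : (1 : ℝ) ≤ n := by exact_mod_cast hn
  have hp : 0 < (n : ℝ) ^ (1 / 3 : ℝ) := by positivity
  have h1 : Real.exp (-n) ≤ 1 / (n : ℝ) ^ (1 / 3 : ℝ) := by
    rw [Real.exp_neg, ← one_div]
    refine one_div_le_one_div_of_le hp ?_
    have := Real.rpow_le_rpow_of_exponent_le hn1 (by norm_num : (1 / 3 : ℝ) ≤ 1)
    rw [Real.rpow_one] at this
    linarith [Real.add_one_le_exp (n : ℝ)]
  have h2 : 2 / √n ≤ 2 / (n : ℝ) ^ (1 / 3 : ℝ) := by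
    refine div_le_div_of_nonneg_left zero_le_two hp ?_
    rw [Real.sqrt_eq_rpow]
    exact Real.rpow_le_rpow_of_exponent_le hn1 (by norm_num)
  have h3 := mul_le_mul_of_nonneg_left h2 hK0
  rw [show (2 * K + 2) / (n : ℝ) ^ (1 / 3 : ℝ)
    = 2 * (1 / (n : ℝ) ^ (1 / 3 : ℝ)) + K * (2 / (n : ℝ) ^ (1 / 3 : ℝ)) by ring]
  linarith

theorem exp_neg_mul_poisson_deviation_le {t s : ℝ} (ht : 1 ≤ t) (hs : 0 < s) (hst : s ^ 2 = t) :
    Real.exp (-t) * ((s + t / s) / 2 * (Real.exp t / (t + 1)) + s / 2 * ((Real.exp t - 1) / t)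
        + 1 / (2 * s) * ((t + 1) ^ 2 * ((Real.exp t - 1) / t) - (t + 1) * Real.exp t))
      ≤ 2 / s := by
  have ht0 : 0 < t := by linarith
  have hE : Real.exp (-t) * Real.exp t = 1 := by rw [← Real.exp_add, neg_add_cancel, Real.exp_zero]
  have hQ : Real.exp (-t) * ((Real.exp t - 1) / t) ≤ 1 / t := by
    rw [mul_div_assoc', mul_sub, hE]
    gcongr
    linarith [Real.exp_pos (-t)]
  calc _ = (s + t / s) / 2 * ((Real.exp (-t) * Real.exp t) / (t + 1))
        + (s / 2 + (t + 1) ^ 2 / (2 * s)) * (Real.exp (-t) * ((Real.exp t - 1) / t))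
        - (t + 1) / (2 * s) * (Real.exp (-t) * Real.exp t) := by ring
    _ ≤ (s + t / s) / 2 * (1 / (t + 1)) + (s / 2 + (t + 1) ^ 2 / (2 * s)) * (1 / t)
        - (t + 1) / (2 * s) * 1 := by
      rw [hE]
      gcongr
    -- The correction has a favourable sign exactly because `t ≥ 1`.
    _ = 2 / s - (t - 1) / (2 * s * t * (t + 1)) := by
      subst hst
      field_simp
      ring
    _ ≤ 2 / s := by
      have : 0 ≤ (t - 1) / (2 * s * t * (t + 1)) :=
        div_nonneg (by linarith) (by positivity)
      linarith

/-- A quantitative Chernoff `√n`-lemma: a power bound of Ritt type for a contraction `c` controls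
the distance of `c ^ n` to `exp (n (c - 1))`. -/
theorem norm_pow_sub_exp_le [NormedAlgebra ℂ A] [CompleteSpace A] (hc : ∀ n, ‖c ^ n‖ ≤ 1)
    (hK : ∀ n : ℕ, 1 ≤ n → ‖c ^ n * (1 - c)‖ ≤ K / ((n : ℝ) + 1)) {n : ℕ} (hn : 1 ≤ n) :
    ‖c ^ n - NormedSpace.exp ((n : ℂ) • (c - 1))‖ ≤ (2 * K + 2) / (n : ℝ) ^ (1 / 3 : ℝ) := by
  have hK0 : 0 ≤ K := by
    have := (norm_nonneg _).trans (hK 1 le_rfl)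
    norm_num at this
    linarith
  have hn1 : (1 : ℝ) ≤ n := by exact_mod_cast hn
  have hs : 0 < √(n : ℝ) := by positivity
  have hst : √(n : ℝ) ^ 2 = n := Real.sq_sqrt (by positivity)
  -- The Poisson standard deviation, which balances the two halves of the bound on `|n - m|`.
  set s := √(n : ℝ)
  set p : ℕ → ℝ := fun m => Real.exp (-n) * ((n : ℝ) ^ m / m.factorial) with hp
  have hp0 : ∀ m, 0 ≤ p m := fun m => by positivity
  have hp1 : HasSum p 1 := by
    have := (hasSum_pow_div_factorial n).mul_left (Real.exp (-n))
    rwa [← Real.exp_add, neg_add_cancel, Real.exp_zero] at this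
  have hdiff : HasSum (fun m => ((p m : ℝ) : ℂ) • (c ^ n - c ^ m))
      (c ^ n - NormedSpace.exp ((n : ℂ) • (c - 1))) := by
    have h1 := (Complex.hasSum_ofReal.mpr hp1).smul_const (c ^ n)
    rw [Complex.ofReal_one, one_smul] at h1
    have h2 := hasSum_exp_smul_sub_one c n
    rw [Complex.ofReal_natCast] at h2
    exact (h1.sub h2).congr_fun fun m => by rw [smul_sub]
  have hdev := (hasSum_poisson_deviation (t := n) (s := s) (by positivity) (by positivity)
    hs.ne').mul_left (Real.exp (-n))
  -- The telescoped bound needs `m ≥ 1`; the term `m = 0` has weight `exp (-n)` and norm at most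
  -- `2`.
  have hsum := (hasSum_ite_eq (0 : ℕ) (2 * Real.exp (-n))).add (hdev.mul_left K)
  rw [← hdiff.tsum_eq]
  refine (tsum_of_norm_bounded hsum fun m => ?_).trans
    (le_trans ?_ (two_mul_exp_neg_add_le hK0 hn))
  · rw [norm_smul, Complex.norm_real, Real.norm_of_nonneg (hp0 m)]
    rcases Nat.eq_zero_or_pos m with rfl | hm
    · have h1 : ‖c ^ n - c ^ 0‖ ≤ 2 := (norm_sub_le _ _).trans (by linarith [hc n, hc 0])
      have h2 : p 0 = Real.exp (-n) := by simp [hp]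
      rw [h2, if_pos rfl]
      have h3 := mul_le_mul_of_nonneg_left h1 (Real.exp_pos (-(n : ℝ))).le
      refine le_add_of_le_of_nonneg (by linarith) ?_
      positivity
    · rw [if_neg hm.ne', zero_add]
      have habs : |(n : ℝ) - m| ≤ (s + ((n : ℝ) - m) ^ 2 / s) / 2 := by
        rw [← sq_abs ((n : ℝ) - m), ← sub_nonneg]
        have : (s + |(n : ℝ) - m| ^ 2 / s) / 2 - |(n : ℝ) - m|
            = (s - |(n : ℝ) - m|) ^ 2 / (2 * s) := by
          field_simp
          ring
        rw [this]
        positivity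
      calc p m * ‖c ^ n - c ^ m‖
          ≤ p m * (K * ((s + ((n : ℝ) - m) ^ 2 / s) / 2
              * (1 / ((n : ℝ) + 1) + 1 / ((m : ℝ) + 1)))) := by
            refine mul_le_mul_of_nonneg_left ?_ (hp0 m)
            refine (norm_pow_sub_pow_le hK hK0 hn hm).trans ?_
            gcongr
        _ = _ := by
            simp only [hp]
            ring
  · have := mul_le_mul_of_nonneg_left (exp_neg_mul_poisson_deviation_le hn1 hs hst) hK0
    linarith

end Chernoff

theorem theorem3 (α : ℝ) (hα₀ : 0 ≤ α) (hα : α < Real.pi / 2) :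
    ∃ K : ℝ, ∀ (H : Type*) [NormedAddCommGroup H] [InnerProductSpace ℂ H] [CompleteSpace H]
      (C : H →L[ℂ] H), IsQuasiSectorialContraction α C →
      (∀ n : ℕ, ‖C ^ n * (1 - C)‖ ≤ K / ((n : ℝ) + 1)) ∧
      (∀ n : ℕ, 1 ≤ n →
        ‖C ^ n - NormedSpace.exp ((n : ℂ) • (C - 1))‖ ≤ (2 * K + 2) / (n : ℝ) ^ (1 / 3 : ℝ)) ∧
      ∀ K' : ℝ, (∀ n : ℕ, 1 ≤ n → ‖C ^ n * (1 - C)‖ ≤ K' / ((n : ℝ) + 1)) →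
        ∀ n : ℕ, 1 ≤ n →
          ‖C ^ n - NormedSpace.exp ((n : ℂ) • (C - 1))‖ ≤
            (2 * K' + 2) / (n : ℝ) ^ (1 / 3 : ℝ) := by
  obtain ⟨r, hr0, hr⟩ := exists_forall_quasiSector_norm_le_one hα₀ hα
  refine ⟨2 / r, fun H _ _ _ C hC => ?_⟩
  have hpow : ∀ n, ‖C ^ n‖ ≤ 1 := fun n => by
    induction n with
    | zero => exact ContinuousLinearMap.norm_id_le
    | succ n ih =>
      rw [pow_succ]
      exact (norm_mul_le _ _).trans (mul_le_one₀ ih (norm_nonneg _) hC.norm_le_one)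
  have hRitt := norm_pow_mul_one_sub_le hr0 hr hC.numRange_subset
  exact ⟨hRitt, fun n hn => norm_pow_sub_exp_le hpow (fun m _ => hRitt m) hn,
    fun K' hK' n hn => norm_pow_sub_exp_le hpow hK' hn⟩
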